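/- Let $n\ge 2$ and let $\sigma$ be the surface measure on the unit sphere $\mathbb S^{n-1}=\{x\in\mathbb R^n:\|x\|=1\}$ (Euclidean norm). For a polynomial $f\in\mathbb R[x_1,\dots,x_n]$ let $f_{\min}=\min_{x\in\mathbb S^{n-1}}f(x)$, and for $r\in\mathbb N$ let $$\overline f^{(r)}=\inf_h\Big\{\int_{\mathbb S^{n-1}}h(x)f(x)\,d\sigma(x)\ :\ \int_{\mathbb S^{n-1}}h(x)\,d\sigma(x)=1\Big\},$$ where $h$ ranges over the sums of squares of polynomials in $\mathbb R[x_1,\dots,x_n]$ such that $h$ has degree at most $2r$. (i) For every polynomial $f\in\mathbb R[x_1,\dots,x_n]$ we have $\overline f^{(r)}-f_{\min}=O(1/r^2)$: there is a constant $C>0$, depending on $n$ and $f$, such that $|\overline f^{(r)}-f_{\min}|\le C/r^2$ for all integers $r\ge1$. (ii) For every polynomial $f$ of degree exactly one, that is, $f(x)=c_0+c^{T}x$ with $c_0\in\mathbb R$ and $0\ne c\in\mathbb R^n$ (in particular for every nonzero linear form and for each coordinate polynomial $x_i$), we have $\overline f^{(r)}-f_{\min}=\Omega(1/r^2)$: there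 is a constant $\gamma>0$, depending on $n$ and $f$, such that $\overline f^{(r)}-f_{\min}\ge\gamma/r^2$ for all integers $r\ge1$. -/

import Mathlib

open MeasureTheory

noncomputable section

/-- The unit sphere `S^{n-1}` of `ℝⁿ` with the Euclidean norm. -/
abbrev UnitSphere (n : ℕ) : Type :=
  Metric.sphere (0 : EuclideanSpace ℝ (Fin n)) 1

/-- The surface measure on the unit sphere (total mass: the surface area of the sphere). -/
def surfaceMeasure (n : ℕ) : Measure (UnitSphere n) :=
  (volume : Measure (EuclideanSpace ℝ (Fin n))).toSphere

/-- The polynomial function of `f` on the unit sphere. -/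
def sphereEval {n : ℕ} (f : MvPolynomial (Fin n) ℝ) (x : UnitSphere n) : ℝ :=
  MvPolynomial.eval (fun i => (x : EuclideanSpace ℝ (Fin n)) i) f

/-- The minimum of `f` on the unit sphere. -/
def sphereMin {n : ℕ} (f : MvPolynomial (Fin n) ℝ) : ℝ :=
  sInf (Set.range (sphereEval f))

/-- The sum-of-squares densities of degree at most `2r` with respect to the surface measure. -/
def IsSOSDensity {n : ℕ} (r : ℕ) (h : MvPolynomial (Fin n) ℝ) : Prop :=
  IsSumSq h ∧ h.totalDegree ≤ 2 * r ∧ ∫ x, sphereEval h x ∂(surfaceMeasure n) = 1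

/-- The expected values of `f` with respect to the sum-of-squares densities of degree at most
`2r`. -/
def sosValues {n : ℕ} (f : MvPolynomial (Fin n) ℝ) (r : ℕ) : Set ℝ :=
  {v | ∃ h : MvPolynomial (Fin n) ℝ, IsSOSDensity r h ∧
    v = ∫ x, sphereEval h x * sphereEval f x ∂(surfaceMeasure n)}

/-- The Lasserre upper bound of order `r`. -/
def lasserreUpper {n : ℕ} (f : MvPolynomial (Fin n) ℝ) (r : ℕ) : ℝ :=
  sInf (sosValues f r)

instance {n : ℕ} : IsFiniteMeasure (surfaceMeasure n) := by
  unfold surfaceMeasure; infer_instance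

theorem continuous_sphereEval {n : ℕ} (f : MvPolynomial (Fin n) ℝ) :
    Continuous (sphereEval f) := by
  unfold sphereEval
  exact (MvPolynomial.continuous_eval f).comp (by fun_prop)

/-- The minimum over the sphere is attained. -/
theorem isLeast_sphereMin {n : ℕ} (hn : 1 ≤ n) (f : MvPolynomial (Fin n) ℝ) :
    IsLeast (Set.range (sphereEval f)) (sphereMin f) := by
  have : Nonempty (Fin n) := ⟨⟨0, hn⟩⟩
  have : Nonempty (UnitSphere n) :=
    (NormedSpace.sphere_nonempty (x := (0 : EuclideanSpace ℝ (Fin n)))).2 zero_le_one |>.to_subtype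
  exact (isCompact_range (continuous_sphereEval f)).isLeast_sInf (Set.range_nonempty _)

theorem sphereMin_mem_lowerBounds {n : ℕ} (hn : 1 ≤ n) (f : MvPolynomial (Fin n) ℝ) (r : ℕ) :
    sphereMin f ∈ lowerBounds (sosValues f r) := by
  rintro v ⟨h, ⟨hs, -, hi⟩, rfl⟩
  have hint : ∀ g : UnitSphere n → ℝ, Continuous g → Integrable g (surfaceMeasure n) := fun g hg =>
    hg.integrable_of_hasCompactSupport (HasCompactSupport.of_compactSpace g)
  have hnn : ∀ x, 0 ≤ sphereEval h x := fun x => by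
    clear hi
    induction hs with
    | zero => simp [sphereEval]
    | sq_add a _ ih =>
      simp only [sphereEval, map_add, map_mul] at ih ⊢
      exact add_nonneg (mul_self_nonneg _) ih
  have hch := continuous_sphereEval h
  have hcf := continuous_sphereEval f
  calc sphereMin f = ∫ x, sphereEval h x * sphereMin f ∂(surfaceMeasure n) := by
        rw [integral_mul_const, hi, one_mul]
    _ ≤ _ := integral_mono (hint _ (hch.mul continuous_const)) (hint _ (hch.mul hcf)) fun x =>
        mul_le_mul_of_nonneg_left ((isLeast_sphereMin hn f).2 ⟨x, rfl⟩) (hnn x)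

theorem sosValues_nonempty {n : ℕ} (hn : 1 ≤ n) (f : MvPolynomial (Fin n) ℝ) (r : ℕ) :
    (sosValues f r).Nonempty := by
  have : Nonempty (Fin n) := ⟨⟨0, hn⟩⟩
  have hpos : 0 < (surfaceMeasure n).real Set.univ := by
    have h0 : surfaceMeasure n ≠ 0 := by
      unfold surfaceMeasure
      exact Measure.toSphere_ne_zero _
    have : NeZero (surfaceMeasure n) := ⟨h0⟩
    exact measureReal_univ_pos
  set c : ℝ := ((surfaceMeasure n).real Set.univ)⁻¹
  have hc : 0 ≤ c := inv_nonneg.2 hpos.le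
  refine ⟨_, MvPolynomial.C c, ⟨?_, by simp, ?_⟩, rfl⟩
  · have : MvPolynomial.C c = MvPolynomial.C (√c) * (MvPolynomial.C (√c) : MvPolynomial (Fin n) ℝ)
      := by rw [← map_mul, Real.mul_self_sqrt hc]
    rw [this]
    exact IsSumSq.mul_self _
  · simp [sphereEval, c, hpos.ne']

/-- The Lasserre upper bound is a genuine infimum: of a nonempty set that is bounded below. -/
theorem isGLB_lasserreUpper {n : ℕ} (hn : 1 ≤ n) (f : MvPolynomial (Fin n) ℝ) (r : ℕ) :
    IsGLB (sosValues f r) (lasserreUpper f r) :=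
  isGLB_csInf (sosValues_nonempty hn f r) ⟨_, sphereMin_mem_lowerBounds hn f r⟩

end

open MeasureTheory

/-! Lower bound: for a degree-one polynomial, write the sphere integral as an average over the
circles swept by rotations in a plane containing the gradient direction `u`. On each circle a
density of degree `2r` is a nonnegative trigonometric polynomial of degree at most `2r`, and `⟪u,
x⟫` is `ρ cos (θ + α)` with `ρ ≤ 1`. Equidistant quadrature with `2r + 2` nodes is exact for the
product, and the nodes can be shifted so that the cosine is at least `-cos (π / (2r + 2))` at all of
them. Hence `1 + ⟪u, x⟫` has mean at least `1 - cos (π / (2r + 2))`, which is of order `r⁻²`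
(`one_sub_cos_mul_integral_le`).

Upper bound: at a minimizer `a` the first-order term vanishes tangentially, so `f - f(a) ≤ K (1 -
⟪a, x⟫)` (`exists_sphereEval_sub_le`), and it suffices to find densities giving `1 - ⟪a, x⟫` a mean
of order `r⁻²`. The ideal weight `(1 + s - ⟪a, x⟫)⁻ᵏ` gives mean at most `s`, by integration by
parts along rotations (`integral_one_sub_inner_mul_inv_pow_le`). Two divided differences of a
Chebyshev polynomial `T_m`, raised to the power `2n` and added, match this weight up to constants
with `k = 2n` and `s` of order `m⁻²` (`exists_concentrated_sum_of_squares`); take `m` about `r / n`.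
-/

noncomputable section

/-! ### Plane rotations and circle averages on the sphere. -/

open Real in
/-- The rotation by the angle `θ` in the plane spanned by the orthonormal vectors `u`, `v`. -/
def planeRotation {V : Type*} [NormedAddCommGroup V] [InnerProductSpace ℝ V] (u v : V) (θ : ℝ)
    (x : V) : V :=
  x + ((cos θ - 1) * inner ℝ u x - sin θ * inner ℝ v x) • u +
    ((cos θ - 1) * inner ℝ v x + sin θ * inner ℝ u x) • v

section Rotation

variable {V : Type*} [NormedAddCommGroup V] [InnerProductSpace ℝ V] {u v : V}

theorem inner_left_planeRotation (hu : ‖u‖ = 1) (huv : inner ℝ u v = 0) (θ : ℝ) (x : V) :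
    inner ℝ u (planeRotation u v θ x) = Real.cos θ * inner ℝ u x - Real.sin θ * inner ℝ v x := by
  simp only [planeRotation, inner_add_right, inner_smul_right, huv, real_inner_self_eq_norm_sq, hu]
  ring

theorem inner_right_planeRotation (hv : ‖v‖ = 1) (huv : inner ℝ u v = 0) (θ : ℝ) (x : V) :
    inner ℝ v (planeRotation u v θ x) = Real.cos θ * inner ℝ v x + Real.sin θ * inner ℝ u x := by
  have hvu : inner ℝ v u = 0 := by rw [real_inner_comm, huv]
  simp only [planeRotation, inner_add_right, inner_smul_right, hvu, real_inner_self_eq_norm_sq, hv]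
  ring

theorem norm_planeRotation (hu : ‖u‖ = 1) (hv : ‖v‖ = 1) (huv : inner ℝ u v = 0) (θ : ℝ) (x : V) :
    ‖planeRotation u v θ x‖ = ‖x‖ := by
  have hvu : inner ℝ v u = 0 := by rw [real_inner_comm, huv]
  rw [← sq_eq_sq₀ (norm_nonneg _) (norm_nonneg _), ← real_inner_self_eq_norm_sq,
    ← real_inner_self_eq_norm_sq]
  simp only [planeRotation, inner_add_right, inner_add_left, inner_smul_right, inner_smul_left,
    huv, hvu, real_inner_self_eq_norm_sq, hu, hv, real_inner_comm u x, real_inner_comm v x]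
  simp only [conj_trivial]
  have := Real.sin_sq_add_cos_sq θ
  linear_combination ((inner ℝ u x) ^ 2 + (inner ℝ v x) ^ 2) * this

/-- `planeRotation` as a linear isometry equivalence. -/
def planeRotationEquiv [FiniteDimensional ℝ V] (hu : ‖u‖ = 1) (hv : ‖v‖ = 1)
    (huv : inner ℝ u v = 0) (θ : ℝ) : V ≃ₗᵢ[ℝ] V :=
  LinearIsometry.toLinearIsometryEquiv
    { toFun := planeRotation u v θ
      map_add' := fun x y => by
        simp only [planeRotation, inner_add_right]
        module
      map_smul' := fun c x => by
        simp only [planeRotation, inner_smul_right, RingHom.id_apply]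
        module
      norm_map' := norm_planeRotation hu hv huv θ } rfl

theorem planeRotationEquiv_apply [FiniteDimensional ℝ V] (hu : ‖u‖ = 1) (hv : ‖v‖ = 1)
    (huv : inner ℝ u v = 0) (θ : ℝ) (x : V) :
    planeRotationEquiv hu hv huv θ x = planeRotation u v θ x := rfl

end Rotation

/-- The restriction of a linear isometry equivalence to the unit sphere. -/
def sphereMap {n : ℕ} (L : EuclideanSpace ℝ (Fin n) ≃ₗᵢ[ℝ] EuclideanSpace ℝ (Fin n))
    (x : UnitSphere n) : UnitSphere n :=
  ⟨L x, by simp⟩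

open scoped Pointwise in
-- `toSphere` measures a set by the volume of the cone over it, and a linear isometry carries cones
-- to cones and preserves volume.
theorem measurePreserving_sphereMap {n : ℕ}
    (L : EuclideanSpace ℝ (Fin n) ≃ₗᵢ[ℝ] EuclideanSpace ℝ (Fin n)) :
    MeasurePreserving (sphereMap L) (surfaceMeasure n) (surfaceMeasure n) := by
  have hc : Continuous (sphereMap L) := by unfold sphereMap; fun_prop
  refine ⟨hc.measurable, ?_⟩
  ext s hs
  rw [Measure.map_apply hc.measurable hs]
  unfold surfaceMeasure
  rw [Measure.toSphere_apply' _ (hc.measurable hs), Measure.toSphere_apply' _ hs]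
  congr 1
  rw [← (show MeasurePreserving L.toMeasurableEquiv volume volume from
    L.measurePreserving).measure_preimage_equiv 
      (Set.Ioo (0 : ℝ) 1 • (Subtype.val '' s))]
  congr 1
  ext y
  simp only [Set.mem_smul, Set.mem_image, Set.mem_preimage, Subtype.exists, exists_and_right,
    exists_eq_right, LinearIsometryEquiv.coe_toMeasurableEquiv]
  constructor
  · rintro ⟨c, hc, z, ⟨hz, hzs⟩, rfl⟩
    exact ⟨c, hc, L z, ⟨by simpa using hz, hzs⟩, by simp⟩
  · rintro ⟨c, hc, z, ⟨hz, hzs⟩, h⟩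
    refine ⟨c, hc, L.symm z, ⟨by simpa using hz, ?_⟩, ?_⟩
    · simpa [sphereMap] using hzs
    · rw [← map_smul, h, L.symm_apply_apply]

theorem integrable_of_continuous_sphere {n : ℕ} {G : UnitSphere n → ℝ} (hG : Continuous G) :
    Integrable G (surfaceMeasure n) :=
  hG.integrable_of_hasCompactSupport (HasCompactSupport.of_compactSpace G)

/-- A continuous function on the sphere whose averages over the circles of a one-parameter group of
plane rotations are nonnegative has nonnegative integral. -/
theorem integral_nonneg_of_circle_averages {n : ℕ} {u v : EuclideanSpace ℝ (Fin n)}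
    (hu : ‖u‖ = 1) (hv : ‖v‖ = 1) (huv : inner ℝ u v = 0) {G : UnitSphere n → ℝ}
    (hG : Continuous G)
    (h : ∀ x, 0 ≤ ∫ θ in (0 : ℝ)..(2 * Real.pi), G (sphereMap (planeRotationEquiv hu hv huv θ) x)) :
    0 ≤ ∫ x, G x ∂(surfaceMeasure n) := by
  have hcont : Continuous fun p : UnitSphere n × ℝ =>
      G (sphereMap (planeRotationEquiv hu hv huv p.2) p.1) := by
    refine hG.comp (Continuous.subtype_mk ?_ _)
    simp only [planeRotationEquiv_apply, planeRotation]
    fun_prop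
  obtain ⟨M, hM⟩ := (isCompact_range hG.norm).bddAbove
  have hpi : (0 : ℝ) ≤ 2 * Real.pi := by positivity
  have hint : Integrable (fun p : UnitSphere n × ℝ =>
      G (sphereMap (planeRotationEquiv hu hv huv p.2) p.1))
      ((surfaceMeasure n).prod (volume.restrict (Set.Ioc 0 (2 * Real.pi)))) :=
    Integrable.of_bound hcont.aestronglyMeasurable M
      (Filter.Eventually.of_forall fun p => hM ⟨_, rfl⟩)
  -- By Fubini and rotation invariance, the integral of the circle integrals is `2π` times the
  -- integral of `G`.
  have hswap := integral_integral_swap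
    (f := fun (x : UnitSphere n) (θ : ℝ) => G (sphereMap (planeRotationEquiv hu hv huv θ) x)) hint
  have hinv : ∀ θ, ∫ x, G (sphereMap (planeRotationEquiv hu hv huv θ) x) ∂(surfaceMeasure n)
      = ∫ x, G x ∂(surfaceMeasure n) := fun θ => by
    have hm := measurePreserving_sphereMap (planeRotationEquiv hu hv huv θ)
    rw [← integral_map hm.measurable.aemeasurable hG.aestronglyMeasurable, hm.map_eq]
  simp only [hinv, integral_const] at hswap
  have hL : 0 ≤ ∫ x, (∫ θ in Set.Ioc 0 (2 * Real.pi),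
      G (sphereMap (planeRotationEquiv hu hv huv θ) x)) ∂(surfaceMeasure n) :=
    integral_nonneg fun x => by
      have := h x
      rwa [intervalIntegral.integral_of_le hpi] at this
  rw [hswap] at hL
  simp only [MeasurableSet.univ, measureReal_restrict_apply, Set.univ_inter, Real.volume_real_Ioc,
    sub_zero, smul_eq_mul, max_eq_left hpi] at hL
  exact nonneg_of_mul_nonneg_right hL (by positivity)

/-! ### Trigonometric polynomials and equidistant quadrature. -/

open Complex in
/-- The trigonometric polynomials of degree at most `d`, as functions on `ℝ`. -/
def IsTrigPoly (d : ℕ) (g : ℝ → ℂ) : Prop :=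
  ∃ P : Polynomial ℂ, P.natDegree ≤ 2 * d ∧ ∀ θ : ℝ, g θ * exp (θ * I) ^ d = P.eval (exp (θ * I))

namespace IsTrigPoly

open Complex Polynomial

variable {d e : ℕ} {f g : ℝ → ℂ}

theorem add (hf : IsTrigPoly d f) (hg : IsTrigPoly d g) : IsTrigPoly d (fun θ => f θ + g θ) := by
  obtain ⟨P, hP, hfP⟩ := hf
  obtain ⟨Q, hQ, hgQ⟩ := hg
  exact ⟨P + Q, natDegree_add_le_of_degree_le hP hQ, fun θ => by
    rw [eval_add, ← hfP, ← hgQ, add_mul]⟩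

theorem mul (hf : IsTrigPoly d f) (hg : IsTrigPoly e g) :
    IsTrigPoly (d + e) (fun θ => f θ * g θ) := by
  obtain ⟨P, hP, hfP⟩ := hf
  obtain ⟨Q, hQ, hgQ⟩ := hg
  exact ⟨P * Q, natDegree_mul_le.trans (by omega), fun θ => by
    rw [eval_mul, ← hfP, ← hgQ]; ring⟩

theorem const (d : ℕ) (c : ℂ) : IsTrigPoly d (fun _ => c) :=
  ⟨C c * X ^ d, (natDegree_C_mul_X_pow_le c d).trans (by omega), fun θ => by simp⟩

theorem mono (hf : IsTrigPoly d f) (hde : d ≤ e) : IsTrigPoly e f := by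
  have := hf.mul (const (e - d) 1)
  simpa [Nat.add_sub_cancel' hde] using this

theorem cos_sin (a b c : ℂ) :
    IsTrigPoly 1 (fun θ : ℝ => a + b * cos (θ : ℂ) + c * sin (θ : ℂ)) := by
  refine ⟨C ((b - c * I) / 2) * X ^ 2 + C a * X + C ((b + c * I) / 2), by compute_degree, fun θ => ?_⟩
  have h : exp (-θ * I) * exp (θ * I) = 1 := by rw [← exp_add]; simp
  simp only [Complex.cos, Complex.sin, eval_add, eval_mul, eval_C, eval_pow, eval_X, pow_one]
  linear_combination (b / 2 + c * I / 2) * h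

theorem pow (hf : IsTrigPoly d f) (k : ℕ) : IsTrigPoly (k * d) (fun θ => f θ ^ k) := by
  induction k with
  | zero => simpa using const 0 1
  | succ k ih => simpa [pow_succ, add_mul] using ih.mul hf

theorem prod {ι : Type*} (s : Finset ι) {d : ι → ℕ} {f : ι → ℝ → ℂ}
    (h : ∀ i ∈ s, IsTrigPoly (d i) (f i)) :
    IsTrigPoly (∑ i ∈ s, d i) (fun θ => ∏ i ∈ s, f i θ) := by
  classical
  induction s using Finset.induction_on with
  | empty => simpa using const 0 1
  | insert i s hi ih =>
    simp only [Finset.sum_insert hi, Finset.prod_insert hi]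
    exact (h i (Finset.mem_insert_self _ _)).mul
      (ih fun j hj => h j (Finset.mem_insert_of_mem hj))

theorem sum {ι : Type*} (s : Finset ι) {f : ι → ℝ → ℂ} (h : ∀ i ∈ s, IsTrigPoly d (f i)) :
    IsTrigPoly d (fun θ => ∑ i ∈ s, f i θ) := by
  classical
  induction s using Finset.induction_on with
  | empty => simpa using const d 0
  | insert i s hi ih =>
    simp only [Finset.sum_insert hi]
    exact (h i (Finset.mem_insert_self _ _)).add
      (ih fun j hj => h j (Finset.mem_insert_of_mem hj))

/-- A polynomial of total degree `d` in trigonometric polynomials of degree one is a trigonometric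
polynomial of degree `d`. -/
theorem mvPolynomial_eval {n : ℕ} (h : MvPolynomial (Fin n) ℝ) {x : ℝ → Fin n → ℝ}
    (hx : ∀ i, IsTrigPoly 1 (fun θ => (x θ i : ℂ))) :
    IsTrigPoly h.totalDegree (fun θ => (MvPolynomial.eval (x θ) h : ℂ)) := by
  have h1 : ∀ m ∈ h.support, IsTrigPoly h.totalDegree
      (fun θ => ((h.coeff m : ℝ) : ℂ) * ∏ i, (x θ i : ℂ) ^ m i) := fun m hm => by
    have h2 := (const 0 ((h.coeff m : ℝ) : ℂ)).mul
      (prod Finset.univ (fun i _ => (hx i).pow (m i)))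
    refine h2.mono ?_
    simpa [Finsupp.sum_fintype] using MvPolynomial.le_totalDegree hm
  have h3 := sum h.support h1
  convert! h3 using 2 with θ
  simp [MvPolynomial.eval_eq']

end IsTrigPoly

/-- A geometric sum whose ratio is an `N`-th root of unity; `0 < |m| < N` keeps the ratio away from
`1`. -/
theorem sum_exp_int_mul_eq_zero {N : ℕ} {m : ℤ} (hm : m ≠ 0) (hmN : |m| < N) (θ : ℝ) :
    ∑ k ∈ Finset.range N, Complex.exp (m * ((θ + 2 * Real.pi * k / N : ℝ) * Complex.I)) = 0 := by
  have hN : N ≠ 0 := by rintro rfl; simp at hmN; exact absurd (abs_nonneg m) (by omega)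
  have hNC : (N : ℂ) ≠ 0 := by exact_mod_cast hN
  set ζ := Complex.exp (2 * Real.pi * Complex.I * (m / N)) with hζ
  have hζN : ζ ^ N = 1 := by
    rw [hζ, ← Complex.exp_nat_mul, Complex.exp_eq_one_iff]
    exact ⟨m, by field_simp⟩
  have hζ1 : ζ ≠ 1 := by
    rw [hζ, Ne, Complex.exp_eq_one_iff]
    rintro ⟨j, hj⟩
    have h2 : (m : ℂ) = j * N := by
      have := Complex.two_pi_I_ne_zero
      field_simp at hj
      rw [hj, mul_comm]
    have h3 : m = j * N := by exact_mod_cast h2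
    have := Int.eq_zero_of_abs_lt_dvd (Dvd.intro_left j h3.symm) hmN
    exact hm this
  have hterm : ∀ k ∈ Finset.range N,
      Complex.exp (m * ((θ + 2 * Real.pi * k / N : ℝ) * Complex.I))
        = Complex.exp (m * (θ * Complex.I)) * ζ ^ k := fun k _ => by
    rw [hζ, ← Complex.exp_nat_mul, ← Complex.exp_add]
    congr 1
    push_cast
    field_simp
  rw [Finset.sum_congr rfl hterm, ← Finset.mul_sum, geom_sum_eq hζ1, hζN]
  simp

theorem integral_exp_int_mul_eq_zero {m : ℤ} (hm : m ≠ 0) :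
    ∫ θ in (0 : ℝ)..(2 * Real.pi), Complex.exp (m * (θ * Complex.I)) = 0 := by
  have hmC : (m : ℂ) * Complex.I ≠ 0 := by simpa using hm
  have := integral_exp_mul_complex (a := 0) (b := 2 * Real.pi) hmC
  have h2 : ∀ θ : ℝ, (m : ℂ) * (θ * Complex.I) = m * Complex.I * θ := fun θ => by ring
  simp only [h2, this]
  have h1 : Complex.exp (m * Complex.I * (2 * Real.pi)) = 1 := by
    rw [Complex.exp_eq_one_iff]
    exact ⟨m, by ring⟩
  simp [h1]

/-- The equidistant quadrature rule with `N` nodes is exact for the trigonometric polynomials of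
degree less than `N`. -/
theorem IsTrigPoly.integral_eq_sum {d N : ℕ} {g : ℝ → ℂ} (hg : IsTrigPoly d g) (hN : d < N)
    (θ₀ : ℝ) : ∫ θ in (0 : ℝ)..(2 * Real.pi), g θ =
      2 * Real.pi / N * ∑ k ∈ Finset.range N, g (θ₀ + 2 * Real.pi * k / N) := by
  obtain ⟨P, hP, hgP⟩ := hg
  -- The Fourier expansion: the frequencies `j - d` have modulus at most `d < N`, so both sides
  -- retain only frequency zero.
  have hexp : ∀ θ : ℝ, g θ = ∑ j ∈ Finset.range (2 * d + 1),
      P.coeff j * Complex.exp (((j : ℤ) - d : ℤ) * (θ * Complex.I)) := fun θ => by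
    have h0 : Complex.exp (θ * Complex.I) ^ d ≠ 0 := pow_ne_zero _ (Complex.exp_ne_zero _)
    rw [← mul_left_inj' h0, hgP, Polynomial.eval_eq_sum_range' (Nat.lt_succ_of_le hP),
      Finset.sum_mul]
    refine Finset.sum_congr rfl fun j _ => ?_
    rw [mul_assoc, ← Complex.exp_nat_mul, ← Complex.exp_nat_mul, ← Complex.exp_add]
    congr 2
    push_cast
    ring
  have hN0 : (N : ℂ) ≠ 0 := by exact_mod_cast (by omega : N ≠ 0)
  simp only [hexp]
  rw [intervalIntegral.integral_finsetSum fun j _ => by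
    apply Continuous.intervalIntegrable; fun_prop, Finset.sum_comm, Finset.mul_sum]
  refine Finset.sum_congr rfl fun j hj => ?_
  rw [intervalIntegral.integral_const_mul, ← Finset.mul_sum]
  by_cases hjd : ((j : ℤ) - d : ℤ) = 0
  · rw [hjd]
    simp
    field_simp
  · rw [integral_exp_int_mul_eq_zero hjd, sum_exp_int_mul_eq_zero hjd]
    · simp
    · rw [Finset.mem_range] at hj
      rw [abs_lt]; omega

/-! ### The lower bound for polynomials of degree one. -/

theorem sphereEval_nonneg_of_isSumSq {n : ℕ} {h : MvPolynomial (Fin n) ℝ} (hs : IsSumSq h)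
    (x : UnitSphere n) : 0 ≤ sphereEval h x := by
  induction hs with
  | zero => simp [sphereEval]
  | sq_add a _ ih =>
    simp only [sphereEval, map_add, map_mul] at ih ⊢
    exact add_nonneg (mul_self_nonneg _) ih

/-- These odd multiples of `π / N` lie in `[π / N, 2π - π / N]`, hence at distance at least `π / N`
from `2πℤ`. -/
theorem cos_odd_mul_pi_div_le {N k : ℕ} (hk : k < N) :
    Real.cos ((2 * k + 1) * Real.pi / N) ≤ Real.cos (Real.pi / N) := by
  have hN : (0 : ℝ) < N := by exact_mod_cast (by omega : 0 < N)
  have hpi := Real.pi_pos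
  have hkN : (k : ℝ) + 1 ≤ N := by exact_mod_cast hk
  rcases le_total ((2 * k + 1 : ℝ)) N with h | h
  · refine Real.cos_le_cos_of_nonneg_of_le_pi (by positivity) ?_ ?_
    · rw [div_le_iff₀ hN]; nlinarith
    · gcongr
      have : (0 : ℝ) ≤ k := by positivity
      nlinarith
  · rw [← Real.cos_two_pi_sub]
    refine Real.cos_le_cos_of_nonneg_of_le_pi (by positivity) ?_ ?_
    · rw [sub_le_iff_le_add, ← sub_le_iff_le_add', le_div_iff₀ hN]; nlinarith
    · rw [le_sub_iff_add_le, ← add_div, div_le_iff₀ hN]; nlinarith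

/-- A nonnegative trigonometric polynomial of degree at most `N - 2` has a nonnegative integral
against `ρ cos (θ + α) + cos (π / N)`. -/
theorem integral_trigPoly_mul_cos_add_nonneg {d N : ℕ} (hN : d + 1 < N) {g : ℝ → ℝ}
    (hg : IsTrigPoly d (fun θ => (g θ : ℂ))) (hg0 : ∀ θ, 0 ≤ g θ) {ρ : ℝ} (hρ0 : 0 ≤ ρ)
    (hρ1 : ρ ≤ 1) (α : ℝ) :
    0 ≤ ∫ θ in (0 : ℝ)..(2 * Real.pi), g θ * (ρ * Real.cos (θ + α) + Real.cos (Real.pi / N)) := by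
  have htrig : IsTrigPoly (d + 1)
      (fun θ => ((g θ * (ρ * Real.cos (θ + α) + Real.cos (Real.pi / N)) : ℝ) : ℂ)) := by
    convert! hg.mul (IsTrigPoly.cos_sin (Real.cos (Real.pi / N)) (ρ * Real.cos α)
      (-(ρ * Real.sin α))) using 2 with θ
    rw [Real.cos_add]
    push_cast
    ring
  have hN0 : (0 : ℝ) < N := by exact_mod_cast (by omega : 0 < N)
  have hcosN : 0 ≤ Real.cos (Real.pi / N) := by
    refine Real.cos_nonneg_of_neg_pi_div_two_le_of_le ?_ ?_
    · have := Real.pi_pos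
      have : 0 ≤ Real.pi / N := by positivity
      linarith
    · have : (2 : ℝ) ≤ N := by exact_mod_cast (by omega : 2 ≤ N)
      gcongr
  -- This offset puts `θ + α` at `(2k + 1)π / N - π`, so no node is closer than `π / N` to the
  -- minimum of the cosine. At the nodes the second factor is then nonnegative, as `ρ ≤ 1` and `cos
  -- (π / N) ≥ 0`.
  have hq := htrig.integral_eq_sum hN (Real.pi / N - Real.pi - α)
  rw [intervalIntegral.integral_ofReal] at hq
  have hq' : ∫ θ in (0 : ℝ)..(2 * Real.pi),
      g θ * (ρ * Real.cos (θ + α) + Real.cos (Real.pi / N)) = 2 * Real.pi / N *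
      ∑ k ∈ Finset.range N, g (Real.pi / N - Real.pi - α + 2 * Real.pi * k / N) *
        (ρ * Real.cos (Real.pi / N - Real.pi - α + 2 * Real.pi * k / N + α)
          + Real.cos (Real.pi / N)) := by exact_mod_cast hq
  rw [hq']
  refine mul_nonneg (by positivity) (Finset.sum_nonneg fun k hk => mul_nonneg (hg0 _) ?_)
  have harg : Real.pi / N - Real.pi - α + 2 * Real.pi * k / N + α
      = (2 * k + 1) * Real.pi / N - Real.pi := by field_simp; ring
  rw [harg, Real.cos_sub_pi]
  have h1 := cos_odd_mul_pi_div_le (Finset.mem_range.1 hk)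
  nlinarith

/-- Along an orbit each coordinate has the form `a + b cos θ + c sin θ`. -/
theorem isTrigPoly_sphereEval_planeRotation {n : ℕ} {u v : EuclideanSpace ℝ (Fin n)}
    (hu : ‖u‖ = 1) (hv : ‖v‖ = 1) (huv : inner ℝ u v = 0) (h : MvPolynomial (Fin n) ℝ)
    (x : UnitSphere n) :
    IsTrigPoly h.totalDegree
      (fun θ => (sphereEval h (sphereMap (planeRotationEquiv hu hv huv θ) x) : ℂ)) := by
  refine IsTrigPoly.mvPolynomial_eval h fun i => ?_
  convert! IsTrigPoly.cos_sin ((x.1 i - inner ℝ u x.1 * u i - inner ℝ v x.1 * v i : ℝ) : ℂ)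
    ((inner ℝ u x.1 * u i + inner ℝ v x.1 * v i : ℝ) : ℂ)
    ((inner ℝ u x.1 * v i - inner ℝ v x.1 * u i : ℝ) : ℂ) using 2 with θ
  simp only [sphereMap, planeRotationEquiv_apply, planeRotation, PiLp.add_apply, PiLp.smul_apply,
    smul_eq_mul]
  push_cast
  ring

theorem inner_sq_add_inner_sq_le {V : Type*} [NormedAddCommGroup V] [InnerProductSpace ℝ V]
    {u v : V} (hu : ‖u‖ = 1) (hv : ‖v‖ = 1) (huv : inner ℝ u v = 0) (x : V) :
    inner ℝ u x ^ 2 + inner ℝ v x ^ 2 ≤ ‖x‖ ^ 2 := by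
  have hvu : inner ℝ v u = 0 := by rw [real_inner_comm, huv]
  have := real_inner_self_nonneg (x := x - inner ℝ u x • u - inner ℝ v x • v)
  simp only [inner_sub_left, inner_sub_right, inner_smul_left, inner_smul_right, huv, hvu,
    real_inner_self_eq_norm_sq, hu, hv, real_inner_comm u x, real_inner_comm v x,
    conj_trivial] at this
  nlinarith

/-- Under a sum-of-squares density of degree at most `2r`, the expectation of `1 + ⟪u, x⟫` is at
least `1 - cos (π / (2r + 2))`. -/
theorem one_sub_cos_mul_integral_le {n r : ℕ} {u v : EuclideanSpace ℝ (Fin n)}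
    (hu : ‖u‖ = 1) (hv : ‖v‖ = 1) (huv : inner ℝ u v = 0) {h : MvPolynomial (Fin n) ℝ}
    (hs : IsSumSq h) (hd : h.totalDegree ≤ 2 * r) :
    (1 - Real.cos (Real.pi / (2 * r + 2 : ℕ))) * ∫ x, sphereEval h x ∂(surfaceMeasure n) ≤
      ∫ x, sphereEval h x * (1 + inner ℝ u x.1) ∂(surfaceMeasure n) := by
  have hch := continuous_sphereEval h
  have key := integral_nonneg_of_circle_averages hu hv huv
    (G := fun x => sphereEval h x * (inner ℝ u x.1 + Real.cos (Real.pi / (2 * r + 2 : ℕ))))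
    (by fun_prop) fun x => by
      -- The polar form of `z` supplies `ρ` and `α`: the orbit has `u`-coordinate `‖z‖ cos (θ + arg
      -- z)`.
      set z : ℂ := ⟨inner ℝ u x.1, inner ℝ v x.1⟩ with hz
      have hz1 : ‖z‖ ≤ 1 := by
        have h1 := inner_sq_add_inner_sq_le hu hv huv x.1
        rw [norm_eq_of_mem_sphere x] at h1
        rw [← sq_le_sq₀ (norm_nonneg _) zero_le_one, ← Complex.normSq_eq_norm_sq,
          Complex.normSq_apply]
        simp only [hz]
        nlinarith
      have hre : ‖z‖ * Real.cos z.arg = inner ℝ u x.1 := Complex.norm_mul_cos_arg z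
      have him : ‖z‖ * Real.sin z.arg = inner ℝ v x.1 := Complex.norm_mul_sin_arg z
      have h2 := integral_trigPoly_mul_cos_add_nonneg (N := 2 * r + 2) (by omega)
        (isTrigPoly_sphereEval_planeRotation hu hv huv h x)
        (fun θ => sphereEval_nonneg_of_isSumSq hs _) (norm_nonneg z) hz1 z.arg
      convert h2 using 5 with θ
      simp only [sphereMap, planeRotationEquiv_apply]
      rw [inner_left_planeRotation hu huv, ← hre, ← him, Real.cos_add]
      ring
  have hi1 := integrable_of_continuous_sphere hch
  have hi2 : Integrable (fun x : UnitSphere n => sphereEval h x * (1 + inner ℝ u x.1))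
    (surfaceMeasure n) := integrable_of_continuous_sphere (by fun_prop)
  have heq : ∀ x : UnitSphere n,
      sphereEval h x * (inner ℝ u x.1 + Real.cos (Real.pi / (2 * r + 2 : ℕ))) =
      sphereEval h x * (1 + inner ℝ u x.1) -
        (1 - Real.cos (Real.pi / (2 * r + 2 : ℕ))) * sphereEval h x := fun x => by ring
  simp only [heq] at key
  rw [integral_sub hi2 (hi1.const_mul _), integral_const_mul] at key
  linarith

/-- From `1 - cos x ≥ 2x² / π²` on `[-π, π]`, together with `2r + 2 ≤ 4r`. -/
theorem one_div_sq_le_one_sub_cos {r : ℕ} (hr : 1 ≤ r) :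
    1 / (8 * (r : ℝ) ^ 2) ≤ 1 - Real.cos (Real.pi / (2 * r + 2 : ℕ)) := by
  have hr' : (1 : ℝ) ≤ r := by exact_mod_cast hr
  have hpi := Real.pi_pos
  have h := Real.cos_le_one_sub_mul_cos_sq (x := Real.pi / (2 * r + 2 : ℕ)) (by
    rw [abs_of_nonneg (by positivity)]
    exact div_le_self hpi.le (by push_cast; linarith))
  have h2 : 1 / (8 * (r : ℝ) ^ 2) ≤ 2 / Real.pi ^ 2 * (Real.pi / (2 * r + 2 : ℕ)) ^ 2 := by
    have : 2 / Real.pi ^ 2 * (Real.pi / (2 * r + 2 : ℕ)) ^ 2 = 2 / (2 * (r : ℝ) + 2) ^ 2 := by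
      push_cast
      field_simp
    rw [this, div_le_div_iff₀ (by positivity) (by positivity)]
    nlinarith
  linarith

theorem MvPolynomial.eq_C_add_sum_of_totalDegree_le_one {σ R : Type*} [Fintype σ] [CommSemiring R]
    {f : MvPolynomial σ R} (hf : f.totalDegree ≤ 1) :
    f = C (f.coeff 0) + ∑ i, C (f.coeff (Finsupp.single i 1)) * X i := by
  classical
  ext m
  simp only [coeff_add, coeff_C, coeff_sum, coeff_C_mul, coeff_X]
  by_cases hm : 1 < m.degree
  · rw [coeff_eq_zero_of_totalDegree_lt (lt_of_le_of_lt hf hm),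
      if_neg (by rintro rfl; simp at hm), zero_add, eq_comm]
    refine Finset.sum_eq_zero fun i _ => ?_
    rw [if_neg (by rintro rfl; simp at hm), mul_zero]
  · rcases Nat.le_one_iff_eq_zero_or_eq_one.1 (not_lt.1 hm) with h0 | h1
    · rw [Finsupp.degree_eq_zero_iff] at h0
      subst h0
      simp
    · obtain ⟨i, rfl⟩ : ∃ i, m = Finsupp.single i 1 := by
        exact (Finsupp.sum_eq_one_iff m).1 h1
      rw [if_neg (by intro h; simpa using DFunLike.congr_fun h i), zero_add,
        Finset.sum_eq_single i]
      · simp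
      · intro j _ hj
        rw [if_neg (by simpa [Finsupp.single_left_inj] using hj), mul_zero]
      · simp

/-- A polynomial of degree one restricts to the sphere as a nonconstant affine function. -/
theorem sphereEval_of_totalDegree_eq_one {n : ℕ} {f : MvPolynomial (Fin n) ℝ}
    (hf : f.totalDegree = 1) : ∃ (b : ℝ) (c : EuclideanSpace ℝ (Fin n)), c ≠ 0 ∧
      ∀ x : UnitSphere n, sphereEval f x = b + inner ℝ c x.1 := by
  have h := MvPolynomial.eq_C_add_sum_of_totalDegree_le_one hf.le
  refine ⟨f.coeff 0, WithLp.toLp 2 fun i => f.coeff (Finsupp.single i 1), fun hc => ?_, fun x => ?_⟩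
  · have hc' : ∀ i, f.coeff (Finsupp.single i 1) = 0 := fun i => by
      simpa using congrArg (fun v : EuclideanSpace ℝ (Fin n) => v i) hc
    rw [h] at hf
    simp [hc'] at hf
  · rw [sphereEval]
    conv_lhs => rw [h]
    simp [PiLp.inner_apply, mul_comm]

theorem exists_unit_orthogonal {n : ℕ} (hn : 2 ≤ n) (u : EuclideanSpace ℝ (Fin n)) :
    ∃ v : EuclideanSpace ℝ (Fin n), ‖v‖ = 1 ∧ inner ℝ u v = 0 := by
  have h1 := (ℝ ∙ u).finrank_add_finrank_orthogonal
  have h2 : Module.finrank ℝ (ℝ ∙ u) ≤ 1 :=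
    (finrank_span_le_card _).trans (by simp)
  rw [finrank_euclideanSpace_fin] at h1
  have : Nontrivial (ℝ ∙ u)ᗮ := Module.nontrivial_of_finrank_pos (R := ℝ) (by omega)
  obtain ⟨w, hw⟩ := exists_ne (0 : (ℝ ∙ u)ᗮ)
  have hw' : (w : EuclideanSpace ℝ (Fin n)) ≠ 0 := by simpa using hw
  refine ⟨(‖w.1‖⁻¹ : ℝ) • w.1, by rw [norm_smul, norm_inv, norm_norm, inv_mul_cancel₀ (by simpa)], ?_⟩
  rw [inner_smul_right, Submodule.mem_orthogonal_singleton_iff_inner_right.1 w.2, mul_zero]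

theorem sphereMin_le_of_affine {n : ℕ} (hn : 1 ≤ n) {f : MvPolynomial (Fin n) ℝ} {b : ℝ}
    {c : EuclideanSpace ℝ (Fin n)} (hc : c ≠ 0)
    (hf : ∀ x : UnitSphere n, sphereEval f x = b + inner ℝ c x.1) :
    sphereMin f ≤ b - ‖c‖ := by
  have hc0 : ‖c‖ ≠ 0 := by simpa using hc
  have h := (isLeast_sphereMin hn f).2
    ⟨⟨-((‖c‖⁻¹ : ℝ) • c), by simp [norm_smul, hc0]⟩, rfl⟩
  rw [hf, inner_neg_right, inner_smul_right, real_inner_self_eq_norm_sq] at h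
  field_simp at h
  linarith

theorem lasserreUpper_sub_sphereMin_ge {n : ℕ} (hn : 2 ≤ n) {f : MvPolynomial (Fin n) ℝ}
    (hf : f.totalDegree = 1) : ∃ c : ℝ, 0 < c ∧ ∀ r : ℕ, 1 ≤ r →
      c / (r : ℝ) ^ 2 ≤ lasserreUpper f r - sphereMin f := by
  obtain ⟨b, c, hc, hfc⟩ := sphereEval_of_totalDegree_eq_one hf
  have hc0 : 0 < ‖c‖ := by simpa using hc
  refine ⟨‖c‖ / 8, by positivity, fun r hr => ?_⟩
  obtain ⟨v, hv, huv⟩ := exists_unit_orthogonal hn ((‖c‖⁻¹ : ℝ) • c)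
  have hu : ‖(‖c‖⁻¹ : ℝ) • c‖ = 1 := by
    rw [norm_smul, norm_inv, norm_norm, inv_mul_cancel₀ hc0.ne']
  rw [le_sub_iff_add_le]
  refine le_csInf (sosValues_nonempty (by omega) f r) ?_
  rintro w ⟨h, ⟨hs, hd, hi⟩, rfl⟩
  have hch := continuous_sphereEval h
  have key := one_sub_cos_mul_integral_le hu hv huv hs hd
  rw [hi, mul_one] at key
  have heq : ∀ x : UnitSphere n, sphereEval h x * sphereEval f x =
      (b - ‖c‖) * sphereEval h x +
        ‖c‖ * (sphereEval h x * (1 + inner ℝ ((‖c‖⁻¹ : ℝ) • c) x.1)) := fun x => by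
    rw [hfc, real_inner_smul_left]
    field_simp
    ring
  have hi2 : Integrable (fun x : UnitSphere n =>
      sphereEval h x * (1 + inner ℝ ((‖c‖⁻¹ : ℝ) • c) x.1)) (surfaceMeasure n) :=
    integrable_of_continuous_sphere (by fun_prop)
  simp only [heq]
  rw [integral_add ((integrable_of_continuous_sphere hch).const_mul _) (hi2.const_mul _),
    integral_const_mul, integral_const_mul, hi, mul_one]
  have h1 := sphereMin_le_of_affine (by omega) hc hfc
  have h2 := one_div_sq_le_one_sub_cos hr
  have h3 : ‖c‖ / 8 / (r : ℝ) ^ 2 = ‖c‖ * (1 / (8 * (r : ℝ) ^ 2)) := by ring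
  have h4 := mul_le_mul_of_nonneg_left (h2.trans key) hc0.le
  linarith

/-! ### Growth of a polynomial near a minimizer on the sphere. -/

/-- First-order Taylor expansion of a polynomial, with a quadratic error bound on the unit ball. -/
theorem exists_linear_approximation {n : ℕ} (f : MvPolynomial (Fin n) ℝ)
    (a : EuclideanSpace ℝ (Fin n)) :
    ∃ (l : EuclideanSpace ℝ (Fin n) →L[ℝ] ℝ) (K : ℝ), ∀ x : EuclideanSpace ℝ (Fin n), ‖x‖ ≤ 1 →
      |MvPolynomial.eval (fun i => x i) f - MvPolynomial.eval (fun i => a i) f - l (x - a)|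
        ≤ K * ‖x - a‖ ^ 2 := by
  induction f using MvPolynomial.induction_on with
  | C c => exact ⟨0, 0, fun x _ => by simp⟩
  | add p q hp hq =>
    obtain ⟨l, K, h⟩ := hp
    obtain ⟨l', K', h'⟩ := hq
    refine ⟨l + l', K + K', fun x hx => ?_⟩
    have := (abs_add_le _ _).trans (add_le_add (h x hx) (h' x hx))
    refine le_of_eq_of_le ?_ (this.trans_eq (by ring))
    congr 1
    rw [map_add, map_add, add_apply]
    ring
  | mul_X p i hp =>
    obtain ⟨l, K, h⟩ := hp
    -- The product rule; the error is that of `p` times `x i`, plus the cross term `l (x - a) * (x i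
    -- - a i)`.
    refine ⟨MvPolynomial.eval (fun i => a i) p • EuclideanSpace.proj i + a i • l, K + ‖l‖,
      fun x hx => ?_⟩
    have hxi : |x i| ≤ 1 := (PiLp.norm_apply_le x i).trans hx
    have hdi : |(x - a) i| ≤ ‖x - a‖ := PiLp.norm_apply_le (x - a) i
    have hl : |l (x - a)| ≤ ‖l‖ * ‖x - a‖ := l.le_opNorm _
    have h1 := mul_le_mul (h x hx) hxi (abs_nonneg _) ((abs_nonneg _).trans (h x hx))
    have h2 := mul_le_mul hl hdi (abs_nonneg _) (by positivity)
    rw [← abs_mul] at h1 h2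
    have h3 := (abs_add_le _ _).trans (add_le_add h1 h2)
    refine le_of_eq_of_le ?_ (h3.trans_eq (by ring))
    congr 1
    have hproj : EuclideanSpace.proj (𝕜 := ℝ) i (x - a) = x i - a i := rfl
    simp only [map_mul, MvPolynomial.eval_X, add_apply, smul_apply, hproj, PiLp.sub_apply,
      smul_eq_mul]
    ring

/-- Near a minimizer `a` on the sphere, a polynomial grows at most linearly in `1 - ⟪a, x⟫`. -/
theorem exists_sphereEval_sub_le {n : ℕ} (f : MvPolynomial (Fin n) ℝ) (a : UnitSphere n)
    (ha : ∀ x, sphereEval f a ≤ sphereEval f x) :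
    ∃ K : ℝ, 0 < K ∧ ∀ x : UnitSphere n,
      sphereEval f x - sphereEval f a ≤ K * (1 - inner ℝ a.1 x.1) := by
  obtain ⟨l, K, h⟩ := exists_linear_approximation f a.1
  have hna : ‖a.1‖ = 1 := norm_eq_of_mem_sphere a
  have hdist : ∀ y : UnitSphere n, ‖y.1 - a.1‖ ^ 2 = 2 * (1 - inner ℝ a.1 y.1) := fun y => by
    rw [norm_sub_sq_real, hna, norm_eq_of_mem_sphere y, real_inner_comm]; ring
  refine ⟨|4 * K - 2 * l a| + 1, by positivity, fun x => ?_⟩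
  have hnx : ‖x.1‖ = 1 := norm_eq_of_mem_sphere x
  set t : ℝ := inner ℝ a.1 x.1 with ht
  have ht1 : t ≤ 1 := by
    have := real_inner_le_norm a.1 x.1
    rwa [hna, hnx, mul_one] at this
  have hy : ‖(2 * t) • a.1 - x.1‖ = 1 := by
    rw [← sq_eq_sq₀ (norm_nonneg _) zero_le_one, norm_sub_sq_real, norm_smul, hna, hnx,
      real_inner_smul_left, ← ht, Real.norm_eq_abs, mul_one, sq_abs]
    ring
  -- The reflection of `x` in the line of `a` has the same height `t` and the opposite tangential
  -- part. Adding the expansion at `y`, where `f(y) ≥ f(a)`, cancels `l (x - a)` up to a multiple of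
  -- `1 - t`, so no Lagrange multiplier is needed.
  let y : UnitSphere n := ⟨(2 * t) • a.1 - x.1, by simpa using hy⟩
  have h1 := (abs_le.1 (h x hnx.le)).2
  have h2 := (abs_le.1 (h y hy.le)).2
  have h3 := ha y
  rw [hdist] at h1 h2
  have h4 : inner ℝ a.1 y.1 = t := by
    simp only [y, inner_sub_right, inner_smul_right, real_inner_self_eq_norm_sq, hna, ← ht]
    ring
  have h5 : l (y.1 - a.1) = - l (x.1 - a.1) - 2 * (1 - t) * l a := by
    simp only [y, map_sub, map_smul, smul_eq_mul]
    ring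
  rw [h4, h5] at h2
  have h6 : (4 * K - 2 * l a) * (1 - t) ≤ (|4 * K - 2 * l a| + 1) * (1 - t) :=
    mul_le_mul_of_nonneg_right ((le_abs_self _).trans (by linarith)) (by linarith)
  simp only [sphereEval] at h3 ⊢
  linarith

/-! ### Integration by parts for zonal functions and the ideal weight. -/

theorem inner_le_one_of_mem_sphere {n : ℕ} {a : EuclideanSpace ℝ (Fin n)} (ha : ‖a‖ = 1)
    (x : UnitSphere n) : inner ℝ a x.1 ≤ 1 := by
  have := real_inner_le_norm a x.1
  rwa [ha, norm_eq_of_mem_sphere x, mul_one] at this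

theorem neg_one_le_inner_of_mem_sphere {n : ℕ} {a : EuclideanSpace ℝ (Fin n)} (ha : ‖a‖ = 1)
    (x : UnitSphere n) : -1 ≤ inner ℝ a x.1 := by
  have := neg_le_of_abs_le (abs_real_inner_le_norm a x.1)
  rwa [ha, norm_eq_of_mem_sphere x, mul_one] at this

/-- Regularity is asked only on `t ≤ 1` because the weights used below have a pole at `1 + s`. -/
theorem continuous_comp_inner_sphere {n : ℕ} {a : EuclideanSpace ℝ (Fin n)} (ha : ‖a‖ = 1)
    {p : ℝ → ℝ} (hp : ContinuousOn p (Set.Iic 1)) :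
    Continuous fun x : UnitSphere n => p (inner ℝ a x.1) :=
  hp.comp_continuous (by fun_prop) fun x => inner_le_one_of_mem_sphere ha x

/-- Integration by parts along the rotations in the plane of `a` and `v`. -/
theorem integral_rotation_by_parts {n : ℕ} {a v : EuclideanSpace ℝ (Fin n)}
    (ha : ‖a‖ = 1) (hv : ‖v‖ = 1) (hav : inner ℝ a v = 0) {p p' : ℝ → ℝ}
    (hp : ∀ t ≤ 1, HasDerivAt p (p' t) t) (hp' : ContinuousOn p' (Set.Iic 1)) :
    ∫ x : UnitSphere n, (inner ℝ a x.1 * p (inner ℝ a x.1)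
      - inner ℝ v x.1 ^ 2 * p' (inner ℝ a x.1)) ∂(surfaceMeasure n) = 0 := by
  have hpc : ContinuousOn p (Set.Iic 1) := fun t ht => (hp t ht).continuousAt.continuousWithinAt
  have hcp := continuous_comp_inner_sphere (n := n) ha hpc
  have hcp' := continuous_comp_inner_sphere (n := n) ha hp'
  have hG : Continuous fun x : UnitSphere n => inner ℝ a x.1 * p (inner ℝ a x.1)
      - inner ℝ v x.1 ^ 2 * p' (inner ℝ a x.1) :=
    (Continuous.mul (by fun_prop) hcp).sub (Continuous.mul (by fun_prop) hcp')
  -- Along each orbit the integrand is the `θ`-derivative of the periodic function `⟪v, x⟫ p ⟪a,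
  -- x⟫`.
  have havg : ∀ x : UnitSphere n, ∫ θ in (0 : ℝ)..(2 * Real.pi),
      (fun x : UnitSphere n => inner ℝ a x.1 * p (inner ℝ a x.1)
        - inner ℝ v x.1 ^ 2 * p' (inner ℝ a x.1)) (sphereMap (planeRotationEquiv ha hv hav θ) x)
      = 0 := fun x => by
    have hrot : Continuous fun θ : ℝ => sphereMap (planeRotationEquiv ha hv hav θ) x := by
      refine Continuous.subtype_mk ?_ _
      simp only [planeRotationEquiv_apply, planeRotation]
      fun_prop
    have hA : ∀ θ : ℝ, inner ℝ a (sphereMap (planeRotationEquiv ha hv hav θ) x).1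
        = Real.cos θ * inner ℝ a x.1 - Real.sin θ * inner ℝ v x.1 :=
      fun θ => inner_left_planeRotation ha hav θ x.1
    have hV : ∀ θ : ℝ, inner ℝ v (sphereMap (planeRotationEquiv ha hv hav θ) x).1
        = Real.cos θ * inner ℝ v x.1 + Real.sin θ * inner ℝ a x.1 :=
      fun θ => inner_right_planeRotation hv hav θ x.1
    have hderiv : ∀ θ : ℝ, HasDerivAt
        (fun θ => (Real.cos θ * inner ℝ v x.1 + Real.sin θ * inner ℝ a x.1) *
          p (Real.cos θ * inner ℝ a x.1 - Real.sin θ * inner ℝ v x.1))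
        ((fun x : UnitSphere n => inner ℝ a x.1 * p (inner ℝ a x.1)
          - inner ℝ v x.1 ^ 2 * p' (inner ℝ a x.1))
          (sphereMap (planeRotationEquiv ha hv hav θ) x)) θ := fun θ => by
      have hle := inner_le_one_of_mem_sphere ha (sphereMap (planeRotationEquiv ha hv hav θ) x)
      rw [hA] at hle
      have h1 : HasDerivAt (fun θ => Real.cos θ * inner ℝ a x.1 - Real.sin θ * inner ℝ v x.1)
          (-Real.sin θ * inner ℝ a x.1 - Real.cos θ * inner ℝ v x.1) θ :=
        ((Real.hasDerivAt_cos θ).mul_const _).sub ((Real.hasDerivAt_sin θ).mul_const _)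
      have h2 : HasDerivAt (fun θ => Real.cos θ * inner ℝ v x.1 + Real.sin θ * inner ℝ a x.1)
          (-Real.sin θ * inner ℝ v x.1 + Real.cos θ * inner ℝ a x.1) θ :=
        ((Real.hasDerivAt_cos θ).mul_const _).add ((Real.hasDerivAt_sin θ).mul_const _)
      have h3 := h2.mul ((hp _ hle).comp θ h1)
      simp only [hA, hV]
      convert! h3 using 1
      simp only [Function.comp_apply]
      ring
    rw [intervalIntegral.integral_eq_sub_of_hasDerivAt (fun θ _ => hderiv θ)
      (hG.comp hrot).continuousOn.intervalIntegrable]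
    simp
  refine le_antisymm ?_ (integral_nonneg_of_circle_averages ha hv hav hG fun x => (havg x).ge)
  have h := integral_nonneg_of_circle_averages ha hv hav hG.neg fun x => by
    simp only [Pi.neg_apply, intervalIntegral.integral_neg]
    exact (neg_eq_zero.2 (havg x)).ge
  simp only [Pi.neg_apply, integral_neg] at h
  linarith

/-- The first moment identity for the zonal functions `p ⟪a, x⟫`. -/
theorem integral_zonal_by_parts {n : ℕ} {a : EuclideanSpace ℝ (Fin n)} (ha : ‖a‖ = 1)
    {p p' : ℝ → ℝ} (hp : ∀ t ≤ 1, HasDerivAt p (p' t) t) (hp' : ContinuousOn p' (Set.Iic 1)) :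
    ∫ x : UnitSphere n, ((n - 1) * (inner ℝ a x.1 * p (inner ℝ a x.1))
      - (1 - inner ℝ a x.1 ^ 2) * p' (inner ℝ a x.1)) ∂(surfaceMeasure n) = 0 := by
  classical
  have hpc : ContinuousOn p (Set.Iic 1) := fun t ht => (hp t ht).continuousAt.continuousWithinAt
  have hcp := continuous_comp_inner_sphere (n := n) ha hpc
  have hcp' := continuous_comp_inner_sphere (n := n) ha hp'
  -- Summing the rotation identity over the `n - 1` basis vectors other than `a` turns `⟪v, x⟫²`
  -- into `1 - ⟪a, x⟫²`.
  obtain ⟨s, b, has, hb⟩ := Orthonormal.exists_orthonormalBasis_extension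
    (𝕜 := ℝ) (E := EuclideanSpace ℝ (Fin n)) (v := {a}) (by
      rw [orthonormal_subtype_iff_ite]
      simp [ha])
  let i₀ : s := ⟨a, has rfl⟩
  have hb0 : b i₀ = a := by rw [hb]
  have hcard : Fintype.card s = n := by
    rw [← Module.finrank_eq_card_basis b.toBasis, finrank_euclideanSpace_fin]
  have hterm : ∀ i ∈ Finset.univ.erase i₀, ∫ x : UnitSphere n,
      (inner ℝ a x.1 * p (inner ℝ a x.1) - inner ℝ (b i) x.1 ^ 2 * p' (inner ℝ a x.1))
        ∂(surfaceMeasure n) = 0 := fun i hi => by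
    refine integral_rotation_by_parts ha (b.orthonormal.1 i) ?_ hp hp'
    rw [← hb0]
    exact b.orthonormal.2 (Finset.ne_of_mem_erase hi).symm
  have hint : ∀ i, Integrable (fun x : UnitSphere n => inner ℝ a x.1 * p (inner ℝ a x.1)
      - inner ℝ (b i) x.1 ^ 2 * p' (inner ℝ a x.1)) (surfaceMeasure n) := fun i =>
    integrable_of_continuous_sphere
      ((Continuous.mul (by fun_prop) hcp).sub (Continuous.mul (by fun_prop) hcp'))
  have hsum := Finset.sum_eq_zero hterm
  rw [← integral_finsetSum _ fun i _ => hint i] at hsum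
  rw [← hsum]
  congr 1
  ext x
  have hx := b.sum_sq_norm_inner_right x.1
  rw [← Finset.add_sum_erase _ _ (Finset.mem_univ i₀), hb0, norm_eq_of_mem_sphere x] at hx
  simp only [Real.norm_eq_abs, sq_abs] at hx
  rw [← eq_sub_iff_add_eq'] at hx
  rw [Finset.sum_sub_distrib, ← Finset.sum_mul, ← Finset.sum_mul, hx, Finset.sum_const, nsmul_eq_mul,
    Finset.card_erase_of_mem (Finset.mem_univ _), Finset.card_univ, hcard,
    Nat.cast_sub (hcard ▸ Fintype.card_pos_iff.2 ⟨i₀⟩)]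
  push_cast
  ring

/-- The density `(1 + s - ⟪a, x⟫)⁻ᵏ` gives `1 - ⟪a, x⟫` an expectation of at most `s`. -/
theorem integral_one_sub_inner_mul_inv_pow_le {n A : ℕ} (hn : 2 ≤ n) (hA : n ≤ A)
    {a : EuclideanSpace ℝ (Fin n)} (ha : ‖a‖ = 1) {s : ℝ} (hs : 0 < s) :
    ∫ x : UnitSphere n, (1 - inner ℝ a x.1) * ((1 + s - inner ℝ a x.1) ^ (A + 1))⁻¹
        ∂(surfaceMeasure n) ≤
      s * ∫ x : UnitSphere n, ((1 + s - inner ℝ a x.1) ^ (A + 1))⁻¹ ∂(surfaceMeasure n) := by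
  have hne : ∀ t : ℝ, t ≤ 1 → 0 < 1 + s - t := fun t ht => by linarith
  have hid := integral_zonal_by_parts (n := n) ha (p := fun t => ((1 + s - t) ^ A)⁻¹)
    (p' := fun t => A * ((1 + s - t) ^ (A + 1))⁻¹)
    (fun t ht => by
      have h0 := (hne t ht).ne'
      have h1 : HasDerivAt (fun t : ℝ => 1 + s - t) (-1) t := (hasDerivAt_id t).const_sub _
      convert! (h1.pow A).inv (pow_ne_zero _ h0) using 1
      rcases A with _ | A
      · simp
      · simp only [Nat.add_sub_cancel]
        rw [Pi.pow_apply]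
        field_simp
        ring)
    (ContinuousOn.mul continuousOn_const (ContinuousOn.inv₀ (by fun_prop)
      fun t ht => pow_ne_zero _ (hne t ht).ne'))
  have hc : Continuous fun x : UnitSphere n => ((1 + s - inner ℝ a x.1) ^ (A + 1))⁻¹ :=
    continuous_comp_inner_sphere ha (p := fun t => ((1 + s - t) ^ (A + 1))⁻¹)
      (ContinuousOn.inv₀ (by fun_prop) fun t ht => pow_ne_zero _ (hne t ht).ne')
  have hc2 : Continuous fun x : UnitSphere n => ((1 + s - inner ℝ a x.1) ^ A)⁻¹ :=
    continuous_comp_inner_sphere ha (p := fun t => ((1 + s - t) ^ A)⁻¹)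
      (ContinuousOn.inv₀ (by fun_prop) fun t ht => pow_ne_zero _ (hne t ht).ne')
  rw [← integral_const_mul, ← sub_nonneg, ← integral_sub
    (integrable_of_continuous_sphere (by fun_prop)) (integrable_of_continuous_sphere (by fun_prop))]
  have hn1 : (0 : ℝ) < n - 1 := by
    have : (2 : ℝ) ≤ n := by exact_mod_cast hn
    linarith
  refine nonneg_of_mul_nonneg_right (a := (n - 1 : ℝ)) ?_ hn1
  rw [← integral_const_mul, ← hid]
  refine integral_mono (integrable_of_continuous_sphere (by fun_prop))
    (integrable_of_continuous_sphere (by fun_prop)) fun x => ?_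
  have ht1 := inner_le_one_of_mem_sphere ha x
  have ht2 := neg_one_le_inner_of_mem_sphere ha x
  dsimp only
  generalize (inner ℝ a x.1 : ℝ) = t at *
  have hy := hne t ht1
  have hpow : ((1 + s - t) ^ A)⁻¹ = (1 + s - t) * ((1 + s - t) ^ (A + 1))⁻¹ := by
    rw [pow_succ]; field_simp
  rw [hpow]
  have hinv : 0 ≤ ((1 + s - t) ^ (A + 1))⁻¹ := by positivity
  have hA' : (n : ℝ) ≤ A := by exact_mod_cast hA
  have h1 : (n : ℝ) * ((1 - t) * (1 + t)) ≤ A * ((1 - t) * (1 + t)) :=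
    mul_le_mul_of_nonneg_right hA' (mul_nonneg (by linarith) (by linarith))
  have h2 : 0 ≤ (n - 1) * ((1 - t) * s) := mul_nonneg hn1.le (mul_nonneg (by linarith) hs.le)
  have h3 : 0 ≤ (1 - t) * (1 + t) := mul_nonneg (by linarith) (by linarith)
  -- Right minus left is `(A - (n - 1))(1 - t²) + (n - 1)s(1 - t)`. So the vanishing integrand of
  -- `hid` is bounded pointwise by `n - 1` times the desired difference.
  have hfac : (n - 1) * (t * (1 + s - t)) - (1 - t ^ 2) * A ≤ (n - 1) * (s - (1 - t)) := by
    nlinarith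
  calc _ = ((n - 1) * (t * (1 + s - t)) - (1 - t ^ 2) * A) * ((1 + s - t) ^ (A + 1))⁻¹ := by ring
    _ ≤ (n - 1) * (s - (1 - t)) * ((1 + s - t) ^ (A + 1))⁻¹ :=
      mul_le_mul_of_nonneg_right hfac hinv
    _ = _ := by ring

/-! ### Chebyshev kernels on `[-1, 1]`. -/

theorem abs_sin_nat_mul_le (m : ℕ) (x : ℝ) : |Real.sin (m * x)| ≤ m * |Real.sin x| := by
  induction m with
  | zero => simp
  | succ m ih =>
    push_cast
    rw [add_mul, one_mul, Real.sin_add]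
    have h1 : |Real.sin (m * x) * Real.cos x| ≤ m * |Real.sin x| := by
      rw [abs_mul]
      exact (mul_le_of_le_one_right (abs_nonneg _) (Real.abs_cos_le_one x)).trans ih
    have h2 : |Real.cos (m * x) * Real.sin x| ≤ |Real.sin x| := by
      rw [abs_mul]
      exact mul_le_of_le_one_left (abs_nonneg _) (Real.abs_cos_le_one _)
    linarith [abs_add_le (Real.sin (m * x) * Real.cos x) (Real.cos (m * x) * Real.sin x)]

namespace Polynomial.Chebyshev

/-- Sum-to-product writes both differences as products of two sines, and `|sin (m x)| ≤ m |sin x|`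
applies to each factor. -/
theorem abs_eval_T_sub_le (m : ℕ) {s t : ℝ} (hs : s ∈ Set.Icc (-1 : ℝ) 1)
    (ht : t ∈ Set.Icc (-1 : ℝ) 1) :
    |(T ℝ m).eval t - (T ℝ m).eval s| ≤ m ^ 2 * |t - s| := by
  rw [← Real.cos_arccos hs.1 hs.2, ← Real.cos_arccos ht.1 ht.2, T_real_cos, T_real_cos]
  generalize Real.arccos s = β
  generalize Real.arccos t = α
  rw [Real.cos_sub_cos, Real.cos_sub_cos]
  have h1 := abs_sin_nat_mul_le m ((α + β) / 2)
  have h2 := abs_sin_nat_mul_le m ((α - β) / 2)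
  have e1 : (((m : ℤ) : ℝ) * α + ((m : ℤ) : ℝ) * β) / 2 = m * ((α + β) / 2) := by push_cast; ring
  have e2 : (((m : ℤ) : ℝ) * α - ((m : ℤ) : ℝ) * β) / 2 = m * ((α - β) / 2) := by push_cast; ring
  rw [e1, e2]
  simp only [abs_mul, abs_neg, abs_two]
  have h3 := mul_le_mul h1 h2 (abs_nonneg _) (by positivity)
  linarith

/-- The divided difference of a Chebyshev polynomial at a point of `[-1, 1]`. -/
theorem exists_dividedDifference_T {m : ℕ} {c : ℝ} (hc : c ∈ Set.Icc (-1 : ℝ) 1) :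
    ∃ Q : Polynomial ℝ, Q.natDegree ≤ m - 1 ∧
      (∀ t, (t - c) * Q.eval t = (T ℝ m).eval t - (T ℝ m).eval c) ∧
      ∀ t ∈ Set.Icc (-1 : ℝ) 1, |Q.eval t| ≤ m ^ 2 := by
  obtain ⟨Q, hQ⟩ := X_sub_C_dvd_sub_C_eval (a := c) (p := T ℝ (m : ℤ))
  have hev : ∀ t, (t - c) * Q.eval t = (T ℝ m).eval t - (T ℝ m).eval c := fun t => by
    have := congrArg (eval t) hQ
    simpa using this.symm
  refine ⟨Q, ?_, hev, ?_⟩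
  · rcases eq_or_ne Q 0 with rfl | hQ0
    · simp
    · have h1 := congrArg natDegree hQ
      rw [natDegree_sub_C, natDegree_T, natDegree_mul (X_sub_C_ne_zero c) hQ0, natDegree_X_sub_C]
        at h1
      simp only [Int.natAbs_natCast] at h1
      omega
  -- Dividing the Lipschitz bound by `|t - c|` requires `t ≠ c`; density and continuity recover the
  -- remaining point.
  · have hclosed : IsClosed {t : ℝ | |Q.eval t| ≤ m ^ 2} :=
      isClosed_le Q.continuous.abs continuous_const
    have hsub : Set.Ioo (-1 : ℝ) 1 ∩ {c}ᶜ ⊆ {t : ℝ | |Q.eval t| ≤ m ^ 2} := fun t ⟨ht, htc⟩ => by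
      have hpos : 0 < |t - c| := abs_pos.2 (sub_ne_zero.2 htc)
      have h1 := abs_eval_T_sub_le m hc ⟨ht.1.le, ht.2.le⟩
      rw [← hev, abs_mul, mul_comm] at h1
      exact le_of_mul_le_mul_right h1 hpos
    have h1 : Set.Icc (-1 : ℝ) 1 ⊆ closure (Set.Ioo (-1 : ℝ) 1 ∩ {c}ᶜ) := by
      rw [← closure_Ioo (by norm_num)]
      exact closure_minimal ((dense_compl_singleton c).open_subset_closure_inter isOpen_Ioo)
        isClosed_closure
    exact h1.trans (closure_minimal hsub hclosed)

/-- Two polynomials of degree less than `m` whose maximum is comparable on `[-1, 1]` to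
`(1 + s - t)⁻¹`, where `s = 1 - cos (π / m)`. -/
theorem exists_kernel_pair {m : ℕ} (hm : 1 ≤ m) :
    ∃ (s : ℝ) (P Q : Polynomial ℝ), 0 < s ∧ s ≤ 5 / m ^ 2 ∧ P.natDegree ≤ m - 1 ∧
      Q.natDegree ≤ m - 1 ∧ ∀ t ∈ Set.Icc (-1 : ℝ) 1,
        (1 + s - t) * |P.eval t| ≤ 12 ∧ (1 + s - t) * |Q.eval t| ≤ 12 ∧
        (1 ≤ (1 + s - t) * |P.eval t| ∨ 1 ≤ (1 + s - t) * |Q.eval t|) := by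
  have hm0 : (0 : ℝ) < m := by exact_mod_cast hm
  have hm1 : (1 : ℝ) ≤ m := by exact_mod_cast hm
  have hpi := Real.pi_pos
  set c := Real.cos (Real.pi / m) with hc
  have hcmem : c ∈ Set.Icc (-1 : ℝ) 1 := Real.cos_mem_Icc _
  -- The base points `1` and `cos (π / m)` are the last two extrema of `T_m`, with values `1` and
  -- `-1`. At any `t`, one of `1 - T_m` and `1 + T_m` is at least `1`, so `P` and `Q` are never both
  -- small.
  obtain ⟨P, hPd, hP, hPb⟩ := exists_dividedDifference_T (m := m) (c := 1) (by simp)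
  obtain ⟨Q, hQd, hQ, hQb⟩ := exists_dividedDifference_T (m := m) hcmem
  have hT1 : (T ℝ m).eval (1 : ℝ) = 1 := T_eval_one ..
  have hTc : (T ℝ m).eval c = -1 := by
    rw [hc, T_real_cos]
    push_cast
    rw [mul_div_cancel₀ _ hm0.ne', Real.cos_pi]
  have hs0 : 0 < 1 - c := by
    have h := Real.cos_lt_cos_of_nonneg_of_le_pi le_rfl (div_le_self hpi.le hm1) (by positivity)
    rw [Real.cos_zero] at h
    linarith
  have hs1 : (1 - c) * m ^ 2 ≤ 5 := by
    have h := Real.one_sub_sq_div_two_le_cos (x := Real.pi / m)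
    have h2 : (1 - c) * m ^ 2 ≤ ((Real.pi / m) ^ 2 / 2) * m ^ 2 :=
      mul_le_mul_of_nonneg_right (by linarith) (by positivity)
    have h3 : ((Real.pi / m) ^ 2 / 2) * m ^ 2 = Real.pi ^ 2 / 2 := by field_simp
    have h4 := Real.pi_lt_d2
    nlinarith
  refine ⟨1 - c, P, Q, hs0, (le_div_iff₀ (by positivity)).2 hs1, hPd, hQd, fun t ht => ?_⟩
  have hTt := abs_eval_T_real_le_one (m : ℤ) (abs_le.2 ⟨ht.1, ht.2⟩)
  rw [abs_le] at hTt
  have hPt := congrArg abs (hP t)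
  have hQt := congrArg abs (hQ t)
  rw [hT1, abs_mul, abs_of_nonpos (sub_nonpos.2 ht.2), 
    abs_of_nonpos (a := eval t (T ℝ m) - 1) (by linarith)] at hPt
  rw [hTc, abs_mul, abs_of_nonneg (a := eval t (T ℝ m) - -1) (by linarith)] at hQt
  have hPs : (1 - c) * |P.eval t| ≤ 5 :=
    (mul_le_mul_of_nonneg_left (hPb t ht) hs0.le).trans hs1
  have hQs : (1 - c) * |Q.eval t| ≤ 5 :=
    (mul_le_mul_of_nonneg_left (hQb t ht) hs0.le).trans hs1
  have hP0 := abs_nonneg (P.eval t)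
  have hQ0 := abs_nonneg (Q.eval t)
  -- The constant `12` is `2 + 5 + 5`: here `|t - c| |Q| ≤ 2` and `(1 - c) |Q| ≤ 5`, the latter used
  -- twice.
  have h1 : (1 - t) * |Q.eval t| ≤ (|t - c| + (1 - c)) * |Q.eval t| :=
    mul_le_mul_of_nonneg_right (by linarith [neg_abs_le (t - c)]) hQ0
  have h2 : |t - c| * |Q.eval t| ≤ (1 + (1 - c) - t) * |Q.eval t| :=
    mul_le_mul_of_nonneg_right (abs_le.2 ⟨by linarith [ht.2], by linarith [ht.2]⟩) hQ0
  have h3 := mul_nonneg hs0.le hP0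
  refine ⟨by nlinarith, by nlinarith, ?_⟩
  rcases le_total ((T ℝ m).eval t) 0 with h | h
  · left; nlinarith
  · right; nlinarith

end Polynomial.Chebyshev

/-- A nonnegative univariate polynomial of degree at most `2N(m-1)`, comparable on `[-1, 1]` to
`(1 + s - t)⁻²ᴺ` with `s` of order `m⁻²`. -/
theorem exists_concentrated_sum_of_squares {m : ℕ} (hm : 1 ≤ m) (N : ℕ) :
    ∃ (s : ℝ) (P Q : Polynomial ℝ), 0 < s ∧ s ≤ 5 / m ^ 2 ∧ P.natDegree ≤ N * (m - 1) ∧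
      Q.natDegree ≤ N * (m - 1) ∧ ∀ t ∈ Set.Icc (-1 : ℝ) 1,
        ((1 + s - t) ^ (2 * N))⁻¹ ≤ P.eval t ^ 2 + Q.eval t ^ 2 ∧
        P.eval t ^ 2 + Q.eval t ^ 2 ≤ 2 * 12 ^ (2 * N) * ((1 + s - t) ^ (2 * N))⁻¹ := by
  obtain ⟨s, P, Q, hs, hsm, hP, hQ, h⟩ := Polynomial.Chebyshev.exists_kernel_pair hm
  refine ⟨s, P ^ N, Q ^ N, hs, hsm, Polynomial.natDegree_pow_le.trans (Nat.mul_le_mul_left N hP),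
    Polynomial.natDegree_pow_le.trans (Nat.mul_le_mul_left N hQ), fun t ht => ?_⟩
  obtain ⟨h1, h2, h3⟩ := h t ht
  have hy : 0 < 1 + s - t := by linarith [ht.2]
  have hk : ∀ z : ℝ, (z ^ N) ^ 2 = ((1 + s - t) * |z|) ^ (2 * N) * ((1 + s - t) ^ (2 * N))⁻¹ :=
    fun z => by
      rw [mul_pow, mul_right_comm, mul_inv_cancel₀ (by positivity), one_mul, pow_mul |z|, sq_abs,
        ← pow_mul, ← pow_mul, mul_comm]
  have hinv : 0 < ((1 + s - t) ^ (2 * N))⁻¹ := by positivity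
  simp only [Polynomial.eval_pow]
  constructor
  · rcases h3 with h3 | h3
    · have := mul_le_mul_of_nonneg_right (one_le_pow₀ h3 (n := 2 * N)) hinv.le
      rw [← hk, one_mul] at this
      linarith [sq_nonneg (Q.eval t ^ N)]
    · have := mul_le_mul_of_nonneg_right (one_le_pow₀ h3 (n := 2 * N)) hinv.le
      rw [← hk, one_mul] at this
      linarith [sq_nonneg (P.eval t ^ N)]
  · have e1 := mul_le_mul_of_nonneg_right (pow_le_pow_left₀ (by positivity) h1 (2 * N)) hinv.le
    have e2 := mul_le_mul_of_nonneg_right (pow_le_pow_left₀ (by positivity) h2 (2 * N)) hinv.le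
    rw [← hk] at e1 e2
    linarith

/-! ### Concentrated densities on the sphere and the upper bound. -/

/-- The linear form `⟪a, x⟫` as a polynomial. -/
def linearForm {n : ℕ} (a : EuclideanSpace ℝ (Fin n)) : MvPolynomial (Fin n) ℝ :=
  ∑ i, MvPolynomial.C (a i) * MvPolynomial.X i

theorem totalDegree_linearForm_le {n : ℕ} (a : EuclideanSpace ℝ (Fin n)) :
    (linearForm a).totalDegree ≤ 1 := by
  refine MvPolynomial.totalDegree_finsetSum_le fun i _ => ?_
  refine (MvPolynomial.totalDegree_mul _ _).trans ?_
  simp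

theorem MvPolynomial.totalDegree_aeval_le {σ R : Type*} [CommSemiring R] {l : MvPolynomial σ R}
    (hl : l.totalDegree ≤ 1) (P : Polynomial R) :
    (Polynomial.aeval l P).totalDegree ≤ P.natDegree := by
  rw [Polynomial.aeval_eq_sum_range]
  refine totalDegree_finsetSum_le fun i hi => ?_
  refine (totalDegree_smul_le _ _).trans ((totalDegree_pow _ _).trans ?_)
  have := Finset.mem_range.1 hi
  nlinarith

theorem sphereEval_aeval_linearForm {n : ℕ} (a : EuclideanSpace ℝ (Fin n)) (P : Polynomial ℝ)
    (x : UnitSphere n) :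
    sphereEval (Polynomial.aeval (linearForm a) P) x = P.eval (inner ℝ a x.1) := by
  have h : MvPolynomial.eval (fun i => x.1 i) (linearForm a) = inner ℝ a x.1 := by
    simp [linearForm, PiLp.inner_apply, mul_comm]
  rw [sphereEval, ← h, ← MvPolynomial.coe_aeval_eq_eval, RingHom.coe_coe,
    ← Polynomial.aeval_algHom_apply]
  simp

/-- There are nonnegative sums of squares of degree at most `2r` that concentrate at `a` at scale
`r⁻¹`. -/
theorem exists_isSumSq_concentrated {n : ℕ} (hn : 2 ≤ n) {a : EuclideanSpace ℝ (Fin n)}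
    (ha : ‖a‖ = 1) {r : ℕ} (hr : 1 ≤ r) :
    ∃ h : MvPolynomial (Fin n) ℝ, IsSumSq h ∧ h.totalDegree ≤ 2 * r ∧
      0 < ∫ x, sphereEval h x ∂(surfaceMeasure n) ∧
      ∫ x, sphereEval h x * (1 - inner ℝ a x.1) ∂(surfaceMeasure n) ≤
        (10 * 12 ^ (2 * n) * n ^ 2 / r ^ 2) * ∫ x, sphereEval h x ∂(surfaceMeasure n) := by
  have hr0 : (0 : ℝ) < r := by exact_mod_cast hr
  -- With `m = r / n + 1` (floor division) the degree `n (m - 1)` is at most `r`, while `m ≥ r / n`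
  -- in the reals gives `s ≤ 5n² / r²`.
  obtain ⟨s, P, Q, hs, hsm, hP, hQ, hPQ⟩ :=
    exists_concentrated_sum_of_squares (m := r / n + 1) (Nat.le_add_left _ _) n
  set p := Polynomial.aeval (linearForm a) P
  set q := Polynomial.aeval (linearForm a) Q
  have hdeg : ∀ R : Polynomial ℝ, R.natDegree ≤ n * (r / n + 1 - 1) →
      (Polynomial.aeval (linearForm a) R).totalDegree ≤ r := fun R hR =>
    (MvPolynomial.totalDegree_aeval_le (totalDegree_linearForm_le a) R).trans
      (hR.trans (by simpa using Nat.mul_div_le r n))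
  have hev : ∀ x : UnitSphere n, sphereEval (p * p + q * q) x =
      P.eval (inner ℝ a x.1) ^ 2 + Q.eval (inner ℝ a x.1) ^ 2 := fun x => by
    rw [← sphereEval_aeval_linearForm, ← sphereEval_aeval_linearForm]
    simp only [sphereEval, map_add, map_mul, p, q]
    ring
  have hb : ∀ x : UnitSphere n,
      ((1 + s - inner ℝ a x.1) ^ (2 * n))⁻¹ ≤ sphereEval (p * p + q * q) x ∧
      sphereEval (p * p + q * q) x ≤
        2 * 12 ^ (2 * n) * ((1 + s - inner ℝ a x.1) ^ (2 * n))⁻¹ := fun x => by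
    rw [hev]
    exact hPQ _ ⟨neg_one_le_inner_of_mem_sphere ha x, inner_le_one_of_mem_sphere ha x⟩
  have hch := continuous_sphereEval (p * p + q * q)
  have hc : Continuous fun x : UnitSphere n => ((1 + s - inner ℝ a x.1) ^ (2 * n))⁻¹ :=
    continuous_comp_inner_sphere ha (p := fun t => ((1 + s - t) ^ (2 * n))⁻¹)
      (ContinuousOn.inv₀ (by fun_prop) fun t ht => by
        have : t ≤ 1 := ht
        exact pow_ne_zero _ (by linarith))
  have hlow : ∫ x : UnitSphere n, ((1 + s - inner ℝ a x.1) ^ (2 * n))⁻¹ ∂(surfaceMeasure n) ≤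
      ∫ x, sphereEval (p * p + q * q) x ∂(surfaceMeasure n) :=
    integral_mono (integrable_of_continuous_sphere hc) (integrable_of_continuous_sphere hch)
      fun x => (hb x).1
  refine ⟨p * p + q * q, (IsSumSq.mul_self p).add (IsSumSq.mul_self q), ?_, ?_, ?_⟩
  · refine (MvPolynomial.totalDegree_add _ _).trans (max_le ?_ ?_) <;>
    refine (MvPolynomial.totalDegree_mul _ _).trans ?_
    · have : p.totalDegree ≤ r := hdeg P hP
      omega
    · have : q.totalDegree ≤ r := hdeg Q hQ
      omega
  · refine lt_of_lt_of_le ?_ hlow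
    have : Nonempty (Fin n) := ⟨⟨0, by omega⟩⟩
    have : NeZero (surfaceMeasure n) := ⟨Measure.toSphere_ne_zero _⟩
    have hpos : ∀ x : UnitSphere n, 0 < ((1 + s - inner ℝ a x.1) ^ (2 * n))⁻¹ := fun x => by
      have : 0 < 1 + s - inner ℝ a x.1 := by linarith [inner_le_one_of_mem_sphere ha x]
      positivity
    rw [integral_pos_iff_support_of_nonneg (fun x => (hpos x).le)
      (integrable_of_continuous_sphere hc), Function.support_eq_univ (fun x => (hpos x).ne')]
    exact Measure.measure_univ_pos.2 (NeZero.ne _)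
  · have h12 : (0 : ℝ) < 2 * 12 ^ (2 * n) := by positivity
    -- The weight exponent `A + 1` must be the even number `2n`, and `A = 2n - 1 ≥ n` is admissible.
    have key := integral_one_sub_inner_mul_inv_pow_le hn (A := 2 * n - 1) (by omega) ha hs
    rw [show 2 * n - 1 + 1 = 2 * n by omega] at key
    have hm : (r : ℝ) / n ≤ (r / n + 1 : ℕ) := by
      have hn0 : (0 : ℝ) < n := by exact_mod_cast (by omega : 0 < n)
      rw [div_le_iff₀ hn0]
      have := (Nat.lt_div_mul_add (a := r) (b := n) (by omega)).le
      have h2 : r ≤ (r / n + 1) * n := by linarith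
      exact_mod_cast h2
    have hn0 : (0 : ℝ) < n := by exact_mod_cast (by omega : 0 < n)
    have hs' : s ≤ 5 * n ^ 2 / r ^ 2 := by
      refine hsm.trans ?_
      have h1 : ((r : ℝ) / n) ^ 2 ≤ ((r / n + 1 : ℕ) : ℝ) ^ 2 :=
        pow_le_pow_left₀ (by positivity) hm 2
      refine (div_le_div_of_nonneg_left (by norm_num) (by positivity) h1).trans_eq ?_
      field_simp
    calc ∫ x, sphereEval (p * p + q * q) x * (1 - inner ℝ a x.1) ∂(surfaceMeasure n)
        ≤ ∫ x : UnitSphere n, 2 * 12 ^ (2 * n) * ((1 - inner ℝ a x.1) *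
            ((1 + s - inner ℝ a x.1) ^ (2 * n))⁻¹) ∂(surfaceMeasure n) := by
          refine integral_mono (integrable_of_continuous_sphere (by fun_prop))
            (integrable_of_continuous_sphere (by fun_prop)) fun x => ?_
          have h1 := mul_le_mul_of_nonneg_right (hb x).2
            (sub_nonneg.2 (inner_le_one_of_mem_sphere ha x))
          dsimp only
          linarith
      _ ≤ 2 * 12 ^ (2 * n) * (s * ∫ x, sphereEval (p * p + q * q) x ∂(surfaceMeasure n)) := by
          rw [integral_const_mul]
          exact mul_le_mul_of_nonneg_left
            (key.trans (mul_le_mul_of_nonneg_left hlow hs.le)) h12.le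
      _ ≤ 2 * 12 ^ (2 * n) * (5 * n ^ 2 / r ^ 2 *
            ∫ x, sphereEval (p * p + q * q) x ∂(surfaceMeasure n)) := by
          refine mul_le_mul_of_nonneg_left (mul_le_mul_of_nonneg_right hs' ?_) h12.le
          exact integral_nonneg fun x => by rw [hev]; positivity
      _ = _ := by ring

theorem isSumSq_C_mul {n : ℕ} {c : ℝ} (hc : 0 ≤ c) {h : MvPolynomial (Fin n) ℝ} (hs : IsSumSq h) :
    IsSumSq (MvPolynomial.C c * h) := by
  rw [← Real.mul_self_sqrt hc, map_mul]
  exact (IsSumSq.mul_self _).mul hs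

theorem lasserreUpper_sub_sphereMin_le {n : ℕ} (hn : 2 ≤ n) (f : MvPolynomial (Fin n) ℝ) :
    ∃ C : ℝ, 0 < C ∧ ∀ r : ℕ, 1 ≤ r →
      |lasserreUpper f r - sphereMin f| ≤ C / (r : ℝ) ^ 2 := by
  obtain ⟨⟨a, ha⟩, hmin⟩ := isLeast_sphereMin (by omega : 1 ≤ n) f
  obtain ⟨K, hK, hf⟩ := exists_sphereEval_sub_le f a fun x => ha ▸ hmin ⟨x, rfl⟩
  have hn0 : (0 : ℝ) < n := by exact_mod_cast (by omega : 0 < n)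
  refine ⟨K * (10 * 12 ^ (2 * n) * n ^ 2), by positivity, fun r hr => ?_⟩
  have hglb := isGLB_lasserreUpper (by omega : 1 ≤ n) f r
  rw [abs_of_nonneg (sub_nonneg.2 (hglb.2 (sphereMin_mem_lowerBounds (by omega) f r)))]
  obtain ⟨h, hsq, hd, hI, hle⟩ :=
    exists_isSumSq_concentrated hn (norm_eq_of_mem_sphere a) hr
  set I := ∫ x, sphereEval h x ∂(surfaceMeasure n) with hIdef
  have hev : ∀ x, sphereEval (MvPolynomial.C I⁻¹ * h) x = I⁻¹ * sphereEval h x := fun x => by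
    simp [sphereEval]
  have hmem : ∫ x, I⁻¹ * sphereEval h x * sphereEval f x ∂(surfaceMeasure n) ∈ sosValues f r := by
    refine ⟨MvPolynomial.C I⁻¹ * h, ⟨isSumSq_C_mul (inv_nonneg.2 hI.le) hsq, ?_, ?_⟩, ?_⟩
    · refine (MvPolynomial.totalDegree_mul _ _).trans ?_
      simpa using hd
    · simp only [hev]
      rw [integral_const_mul, ← hIdef, inv_mul_cancel₀ hI.ne']
    · simp only [hev]
  have hch := continuous_sphereEval h
  have hcf := continuous_sphereEval f
  have hbound : ∫ x, I⁻¹ * sphereEval h x * sphereEval f x ∂(surfaceMeasure n) ≤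
      ∫ x, (I⁻¹ * sphereMin f * sphereEval h x +
        I⁻¹ * K * (sphereEval h x * (1 - inner ℝ a.1 x.1))) ∂(surfaceMeasure n) := by
    refine integral_mono (integrable_of_continuous_sphere (by fun_prop))
      (integrable_of_continuous_sphere (by fun_prop)) fun x => ?_
    have h1 : sphereEval f x ≤ sphereMin f + K * (1 - inner ℝ a.1 x.1) := by
      have := hf x
      rw [ha] at this
      linarith
    have h2 := mul_le_mul_of_nonneg_left h1
      (mul_nonneg (inv_nonneg.2 hI.le) (sphereEval_nonneg_of_isSumSq hsq x))
    dsimp only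
    linarith
  rw [integral_add (integrable_of_continuous_sphere (by fun_prop))
    (integrable_of_continuous_sphere (by fun_prop)), integral_const_mul, integral_const_mul,
    ← hIdef] at hbound
  have h3 := mul_le_mul_of_nonneg_left hle (mul_nonneg (inv_nonneg.2 hI.le) hK.le)
  have h4 : I⁻¹ * K * (10 * 12 ^ (2 * n) * n ^ 2 / (r : ℝ) ^ 2 * I) =
      K * (10 * 12 ^ (2 * n) * n ^ 2) / (r : ℝ) ^ 2 := by field_simp
  have h5 : I⁻¹ * sphereMin f * I = sphereMin f := by field_simp
  have h6 := hglb.1 hmem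
  linarith

end

theorem theorem1 (n : ℕ) (hn : 2 ≤ n) :
    (∀ f : MvPolynomial (Fin n) ℝ,
      ∃ C : ℝ, 0 < C ∧ ∀ r : ℕ, 1 ≤ r →
        |lasserreUpper f r - sphereMin f| ≤ C / (r : ℝ) ^ 2) ∧
    (∀ f : MvPolynomial (Fin n) ℝ, f.totalDegree = 1 →
      ∃ c : ℝ, 0 < c ∧ ∀ r : ℕ, 1 ≤ r →
        c / (r : ℝ) ^ 2 ≤ lasserreUpper f r - sphereMin f) :=
  ⟨lasserreUpper_sub_sphereMin_le hn, fun _ hf => lasserreUpper_sub_sphereMin_ge hn hf⟩
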